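/- Let $G$ be a group (for instance a finite group or a compact Lie group) and let $U$ be a unitary representation of $G$ on a finite-dimensional complex Hilbert space $\mathcal H$. Then $U$ admits a decomposition into irreps, i.e. an orthogonal decomposition $$\mathcal H=\bigoplus_{\mu}\mathcal M_\mu\otimes\mathcal N_\mu,\qquad U(g)=\bigoplus_\mu U_\mu(g)\otimes I_{\mathcal N_\mu}\quad(g\in G),$$ with finitely many $\mu$ and finite-dimensional Hilbert spaces $\mathcal M_\mu,\mathcal N_\mu$, where the $U_\mu$ are pairwise inequivalent irreducible unitary representations of $G$ on $\mathcal M_\mu$. Fix any such decomposition and let $\Pi_\mu$ be the orthogonal projection onto $\mathcal M_\mu\otimes\mathcal N_\mu$. For unit vectors $\psi_1,\psi_2\in\mathcal H$ let $$F_i^{(\mu)}=\mathrm{tr}_{\mathcal N_\mu}\bigl(\Pi_\mu|\psi_i\rangle\langle\psi_i|\Pi_\mu\bigr),\qquad i=1,2,$$ be their reductions onto irreps, which are positive operators on $\mathcal M_\mu$. For positive operators $A,B$ put $\mathrm{Fid}(A,B)=\|\sqrt A\sqrt B\|_1$, where $\|X\|_1=\mathrm{tr}\sqrt{X^\dagger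 X}$ is the trace norm. A unitary $V$ on $\mathcal H$ is called $G$-invariant if $VU(g)=U(g)V$ for all $g\in G$. Then every $G$-invariant unitary $V$ on $\mathcal H$ satisfies $$|\langle\psi_2|V|\psi_1\rangle|\le\sum_\mu\mathrm{Fid}\bigl(F_1^{(\mu)},F_2^{(\mu)}\bigr),$$ and there exists a $G$-invariant unitary $V$ on $\mathcal H$ for which equality holds. -/

import Mathlib

open scoped TensorProduct

universe w u v

noncomputable section

namespace Asymmetry

/-- The linear representation underlying a unitary representation `g ↦ U g`. -/
def toRepresentation {G H : Type*} [Group G] [NormedAddCommGroup H] [InnerProductSpace ℂ H]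
    (U : G →* (H ≃ₗᵢ[ℂ] H)) : Representation ℂ G H where
  toFun g := (U g).toLinearEquiv.toLinearMap
  map_one' := by ext x; simp
  map_mul' g h := by ext x; simp

/-- A unitary `V` is `G`-invariant if `V U(g) = U(g) V` for all `g`. -/
def IsGInvariant {G H : Type*} [Group G] [NormedAddCommGroup H] [InnerProductSpace ℂ H]
    (U : G →* (H ≃ₗᵢ[ℂ] H)) (V : H ≃ₗᵢ[ℂ] H) : Prop :=
  ∀ g : G, V * U g = U g * V

section Operators

variable {M : Type*} [NormedAddCommGroup M] [InnerProductSpace ℂ M] [FiniteDimensional ℂ M]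

/-- The square root of a positive operator. -/
def opSqrt (A : M →L[ℂ] M) : M →L[ℂ] M :=
  haveI : CompleteSpace M := FiniteDimensional.complete ℂ M
  CFC.sqrt A

/-- The trace norm `‖A‖₁ = tr √(A† A)`. -/
def traceNorm (A : M →L[ℂ] M) : ℝ :=
  haveI : CompleteSpace M := FiniteDimensional.complete ℂ M
  (LinearMap.trace ℂ M (opSqrt (ContinuousLinearMap.adjoint A ∘L A)).toLinearMap).re

/-- The fidelity `Fid(A, B) = ‖√A √B‖₁` of two positive operators. -/
def fid (A B : M →L[ℂ] M) : ℝ :=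
  traceNorm (opSqrt A ∘L opSqrt B)

variable {N : Type*} [NormedAddCommGroup N] [InnerProductSpace ℂ N] [FiniteDimensional ℂ N]

/-- The partial trace over the second factor: the linear map with `tr_N (A ⊗ B) = tr(B) A`. -/
def partialTrace : ((M ⊗[ℂ] N) →ₗ[ℂ] (M ⊗[ℂ] N)) →ₗ[ℂ] (M →ₗ[ℂ] M) :=
  (TensorProduct.rid ℂ (M →ₗ[ℂ] M)).toLinearMap ∘ₗ
    LinearMap.lTensor (M →ₗ[ℂ] M) (LinearMap.trace ℂ N) ∘ₗ
      (homTensorHomEquiv ℂ M N M N).symm.toLinearMap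

theorem partialTrace_map (A : M →ₗ[ℂ] M) (B : N →ₗ[ℂ] N) :
    partialTrace (TensorProduct.map A B) = LinearMap.trace ℂ N B • A := by
  have h : (homTensorHomEquiv ℂ M N M N).symm (TensorProduct.map A B) = A ⊗ₜ[ℂ] B := by
    rw [LinearEquiv.symm_apply_eq]
    simp [homTensorHomEquiv_apply]
  simp [partialTrace, h]

end Operators

/-- A decomposition `H = ⨁_μ M_μ ⊗ N_μ` of a unitary representation into irreps: the `M_μ` carry
pairwise inequivalent irreducible unitary representations `U_μ`, the `N_μ` are the multiplicity
spaces, and `U(g) = ⨁_μ U_μ(g) ⊗ 1`. The orthogonal direct sum is given by the isometric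
inclusions of its summands. -/
structure IrrepDecomposition {G : Type u} {H : Type v} [Group G] [NormedAddCommGroup H]
    [InnerProductSpace ℂ H] (U : G →* (H ≃ₗᵢ[ℂ] H)) where
  /-- the labels `μ` -/
  Index : Type w
  [fintypeIndex : Fintype Index]
  /-- the spaces on which the irreps act -/
  M : Index → Type w
  [normedM : ∀ μ, NormedAddCommGroup (M μ)]
  [innerM : ∀ μ, InnerProductSpace ℂ (M μ)]
  [finiteM : ∀ μ, FiniteDimensional ℂ (M μ)]
  /-- the multiplicity spaces -/
  N : Index → Type w
  [normedN : ∀ μ, NormedAddCommGroup (N μ)]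
  [innerN : ∀ μ, InnerProductSpace ℂ (N μ)]
  [finiteN : ∀ μ, FiniteDimensional ℂ (N μ)]
  /-- the irreps `U_μ` -/
  irrep : ∀ μ, G →* (M μ ≃ₗᵢ[ℂ] M μ)
  irreducible : ∀ μ, (toRepresentation (irrep μ)).IsIrreducible
  inequivalent : ∀ μ ν, μ ≠ ν →
    IsEmpty ((toRepresentation (irrep μ)).Equiv (toRepresentation (irrep ν)))
  /-- the inclusions of the summands `M_μ ⊗ N_μ` -/
  incl : ∀ μ, (M μ ⊗[ℂ] N μ) →ₗᵢ[ℂ] H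
  orthogonal : OrthogonalFamily ℂ (fun μ => M μ ⊗[ℂ] N μ) incl
  iSup_range : ⨆ μ, LinearMap.range (incl μ).toLinearMap = ⊤
  map_incl : ∀ (g : G) (μ : Index) (m : M μ) (n : N μ),
    U g (incl μ (m ⊗ₜ[ℂ] n)) = incl μ (irrep μ g m ⊗ₜ[ℂ] n)

attribute [instance] IrrepDecomposition.fintypeIndex IrrepDecomposition.normedM
  IrrepDecomposition.innerM IrrepDecomposition.finiteM IrrepDecomposition.normedN
  IrrepDecomposition.innerN IrrepDecomposition.finiteN

namespace IrrepDecomposition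

variable {G H : Type*} [Group G] [NormedAddCommGroup H] [InnerProductSpace ℂ H]
  [FiniteDimensional ℂ H] {U : G →* (H ≃ₗᵢ[ℂ] H)}

/-- The orthogonal projection `Π_μ` of `H` onto the summand `M_μ ⊗ N_μ`. -/
def proj (D : IrrepDecomposition U) (μ : D.Index) : H →ₗ[ℂ] H :=
  (LinearMap.range (D.incl μ).toLinearMap).starProjection.toLinearMap

/-- The component `ρ^(μ) = tr_{N_μ} (Π_μ ρ Π_μ)` of the reduction of `ρ` onto irreps; here
`Π_μ ρ Π_μ` is read as an operator on `M_μ ⊗ N_μ`. -/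
def reduction (D : IrrepDecomposition U) (ρ : H →ₗ[ℂ] H) (μ : D.Index) :
    D.M μ →L[ℂ] D.M μ :=
  LinearMap.toContinuousLinearMap (partialTrace
    (LinearMap.adjoint (D.incl μ).toLinearMap ∘ₗ (D.proj μ ∘ₗ ρ ∘ₗ D.proj μ) ∘ₗ
      (D.incl μ).toLinearMap))

/-- The reduction onto irreps of the pure state `|ψ⟩⟨ψ|`. -/
def pureReduction (D : IrrepDecomposition U) (ψ : H) (μ : D.Index) : D.M μ →L[ℂ] D.M μ :=
  D.reduction (InnerProductSpace.rankOne ℂ ψ ψ).toLinearMap μ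

end IrrepDecomposition

end Asymmetry

end

/-!
By Schur's lemma a `G`-invariant `V` acts as `⨁_μ 1 ⊗ Y_μ`, so `⟨ψ₂, V ψ₁⟩` splits into one term
per irrep, and the `Y_μ` can be chosen independently. Identify `φ : M ⊗ N` with an operator
`A : N → M` by means of an antiunitary `J` of `N`. Then `tr_N |φ⟩⟨φ| = A A†`, and
`⟨(1 ⊗ Y) φ₁, φ₂⟩ = tr (J Y J⁻¹ A₁† A₂)`. As `Y` runs over the unitaries, the modulus of this trace
has maximum `‖A₁† A₂‖₁`, which equals `Fid (A₁ A₁†, A₂ A₂†)` by polar decomposition; this is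
Uhlmann's theorem.

A decomposition exists by complete reducibility. The multiplicity space of an irrep `M` is its
space of intertwiners `f : M → H`, with the Hilbert space structure given by evaluation at a unit
vector `m₀`: by Schur's lemma `⟨f m, f' m'⟩ = ⟨f m₀, f' m₀⟩ ⟨m, m'⟩`, hence `m ⊗ f ↦ f m` is
isometric.
-/

noncomputable section

namespace Asymmetry

section Polar

variable {V M E : Type*} [AddCommGroup V] [Module ℂ V] [NormedAddCommGroup M]
  [InnerProductSpace ℂ M] [NormedAddCommGroup E] [InnerProductSpace ℂ E]

theorem exists_linearIsometry_range_of_norm_eq (P : V →ₗ[ℂ] M) (K : V →ₗ[ℂ] E)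
    (h : ∀ x, ‖K x‖ = ‖P x‖) :
    ∃ L : LinearMap.range P →ₗᵢ[ℂ] E, ∀ x, L ⟨P x, LinearMap.mem_range_self P x⟩ = K x := by
  obtain ⟨s, hs⟩ := P.rangeRestrict.exists_rightInverse_of_surjective P.range_rangeRestrict
  have hs' : ∀ y, P (s y) = y := fun y => congrArg Subtype.val (LinearMap.congr_fun hs y)
  refine ⟨⟨K ∘ₗ s, fun y => ?_⟩, fun x => ?_⟩
  · rw [LinearMap.comp_apply, h, hs', Submodule.coe_norm]
  · change K (s ⟨P x, _⟩) = K x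
    rw [← sub_eq_zero, ← map_sub, ← norm_eq_zero, h, map_sub, hs', sub_self, norm_zero]

variable [FiniteDimensional ℂ M]

theorem exists_unitary_comp_eq_of_norm_eq (P K : V →ₗ[ℂ] M) (h : ∀ x, ‖K x‖ = ‖P x‖) :
    ∃ W : M ≃ₗᵢ[ℂ] M, W.toLinearEquiv.toLinearMap ∘ₗ P = K := by
  obtain ⟨L, hL⟩ := exists_linearIsometry_range_of_norm_eq P K h
  refine ⟨L.extend.toLinearIsometryEquiv rfl, LinearMap.ext fun x => ?_⟩
  exact (L.extend_apply ⟨P x, LinearMap.mem_range_self P x⟩).trans (hL x)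

variable [FiniteDimensional ℂ E]

theorem norm_adjoint_apply_le {T : M →ₗ[ℂ] E} (hT : ∀ x, ‖T x‖ ≤ ‖x‖) (y : E) :
    ‖LinearMap.adjoint T y‖ ≤ ‖y‖ := by
  have h : ‖LinearMap.adjoint T y‖ * ‖LinearMap.adjoint T y‖
      ≤ ‖y‖ * ‖LinearMap.adjoint T y‖ := by
    rw [← inner_self_eq_norm_mul_norm (𝕜 := ℂ), LinearMap.adjoint_inner_left]
    exact (re_inner_le_norm _ _).trans (by gcongr; exact hT _)
  nlinarith [norm_nonneg (LinearMap.adjoint T y), norm_nonneg y]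

/-- `T` is the partial isometry of the polar decomposition of `K`. -/
theorem exists_contraction_comp_eq_of_norm_eq (P : V →ₗ[ℂ] M) (K : V →ₗ[ℂ] E)
    (h : ∀ x, ‖K x‖ = ‖P x‖) :
    ∃ T : M →ₗ[ℂ] E, (∀ x, ‖T x‖ ≤ ‖x‖) ∧ T ∘ₗ P = K ∧ LinearMap.adjoint T ∘ₗ K = P := by
  obtain ⟨L, hL⟩ := exists_linearIsometry_range_of_norm_eq P K h
  let T : M →ₗ[ℂ] E := L.toLinearMap ∘ₗ (LinearMap.range P).orthogonalProjectionOnto.toLinearMap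
  have hTP : T ∘ₗ P = K := LinearMap.ext fun x =>
    (congrArg L (Submodule.orthogonalProjectionOnto_mem_subspace_eq_self
      (⟨P x, LinearMap.mem_range_self P x⟩ : LinearMap.range P))).trans (hL x)
  refine ⟨T, fun x => ?_, hTP, LinearMap.ext fun x => ext_inner_left ℂ fun y => ?_⟩
  · exact (L.norm_map _).trans_le (Submodule.norm_orthogonalProjectionOnto_apply_le _ _)
  · rw [LinearMap.comp_apply, LinearMap.adjoint_inner_right, ← hL x]
    exact (L.inner_map_map _ _).trans
      (Submodule.inner_orthogonalProjectionOnto_eq_of_mem_right ⟨P x, _⟩ y)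

end Polar

section TraceNorm

variable {M N : Type*} [NormedAddCommGroup M] [InnerProductSpace ℂ M] [FiniteDimensional ℂ M]
  [NormedAddCommGroup N] [InnerProductSpace ℂ N] [FiniteDimensional ℂ N]

theorem norm_trace_comp_le_of_isPositive {C S : M →ₗ[ℂ] M} (hC : ∀ x, ‖C x‖ ≤ ‖x‖)
    (hS : S.IsPositive) : ‖LinearMap.trace ℂ M (C ∘ₗ S)‖ ≤ (LinearMap.trace ℂ M S).re := by
  let b := hS.isSymmetric.eigenvectorBasis rfl
  let s := hS.isSymmetric.eigenvalues rfl
  have hs : ∀ i, 0 ≤ s i := hS.nonneg_eigenvalues rfl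
  have hSb : ∀ i, S (b i) = (s i : ℂ) • b i := hS.isSymmetric.apply_eigenvectorBasis rfl
  have hCb : ∀ i, ‖inner ℂ (b i) (C (b i))‖ ≤ 1 := fun i =>
    calc ‖inner ℂ (b i) (C (b i))‖ ≤ ‖b i‖ * ‖C (b i)‖ := norm_inner_le_norm _ _
      _ ≤ ‖b i‖ * ‖b i‖ := by gcongr; exact hC _
      _ = 1 := by rw [b.orthonormal.1 i, one_mul]
  have htr : (LinearMap.trace ℂ M S).re = ∑ i, s i :=
    hS.isSymmetric.re_trace_eq_sum_eigenvalues rfl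
  rw [LinearMap.trace_eq_sum_inner _ b, htr]
  refine norm_sum_le_of_le _ fun i _ => ?_
  rw [LinearMap.comp_apply, hSb, map_smul, inner_smul_right, norm_mul, Complex.norm_real,
    Real.norm_of_nonneg (hs i)]
  exact mul_le_of_le_one_right (hs i) (hCb i)

theorem isPositive_opSqrt (A : M →L[ℂ] M) : (opSqrt A).toLinearMap.IsPositive := by
  have : CompleteSpace M := FiniteDimensional.complete ℂ M
  rw [ContinuousLinearMap.isPositive_toLinearMap_iff]
  exact (ContinuousLinearMap.nonneg_iff_isPositive _).1 (CFC.sqrt_nonneg A)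

theorem adjoint_opSqrt (A : M →L[ℂ] M) :
    LinearMap.adjoint (opSqrt A).toLinearMap = (opSqrt A).toLinearMap :=
  LinearMap.isSelfAdjoint_iff'.1 (isPositive_opSqrt A).isSelfAdjoint

theorem opSqrt_comp_opSqrt {A : M →L[ℂ] M} (hA : A.toLinearMap.IsPositive) :
    (opSqrt A).toLinearMap ∘ₗ (opSqrt A).toLinearMap = A.toLinearMap := by
  have : CompleteSpace M := FiniteDimensional.complete ℂ M
  rw [ContinuousLinearMap.isPositive_toLinearMap_iff] at hA
  exact congrArg ContinuousLinearMap.toLinearMap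
    (CFC.sqrt_mul_sqrt_self A ((ContinuousLinearMap.nonneg_iff_isPositive _).2 hA))

theorem norm_opSqrt_apply_of_eq_adjoint_comp {A : M →L[ℂ] M} {K : M →ₗ[ℂ] N}
    (hA : A.toLinearMap = LinearMap.adjoint K ∘ₗ K) (x : M) : ‖opSqrt A x‖ = ‖K x‖ := by
  have hpos : A.toLinearMap.IsPositive := hA ▸ LinearMap.isPositive_adjoint_comp_self K
  have h : inner ℂ (opSqrt A x) (opSqrt A x) = inner ℂ (K x) (K x) := by
    rw [← LinearMap.adjoint_inner_right K, ← LinearMap.comp_apply, ← hA,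
      ← opSqrt_comp_opSqrt hpos, LinearMap.comp_apply, ← LinearMap.adjoint_inner_left,
      adjoint_opSqrt]
    rfl
  rw [norm_eq_sqrt_re_inner (𝕜 := ℂ), h, ← norm_eq_sqrt_re_inner]

theorem exists_unitary_comp_isPositive_eq (X : M →L[ℂ] M) :
    ∃ (W : M ≃ₗᵢ[ℂ] M) (S : M →ₗ[ℂ] M), S.IsPositive ∧
      W.toLinearEquiv.toLinearMap ∘ₗ S = X.toLinearMap ∧
      LinearMap.trace ℂ M S = traceNorm X := by
  have : CompleteSpace M := FiniteDimensional.complete ℂ M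
  let R := opSqrt (ContinuousLinearMap.adjoint X ∘L X)
  have hR : R.toLinearMap.IsPositive := isPositive_opSqrt _
  obtain ⟨W, hW⟩ := exists_unitary_comp_eq_of_norm_eq R.toLinearMap X.toLinearMap fun x =>
    (norm_opSqrt_apply_of_eq_adjoint_comp (K := X.toLinearMap) rfl x).symm
  refine ⟨W, R.toLinearMap, hR, hW, ?_⟩
  change _ = ((LinearMap.trace ℂ M R.toLinearMap).re : ℂ)
  simp [hR.isSymmetric.trace_eq_sum_eigenvalues rfl]

theorem norm_trace_comp_le_traceNorm {C : M →ₗ[ℂ] M} (hC : ∀ x, ‖C x‖ ≤ ‖x‖) (X : M →L[ℂ] M) :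
    ‖LinearMap.trace ℂ M (C ∘ₗ X.toLinearMap)‖ ≤ traceNorm X := by
  obtain ⟨W, S, hS, hX, htr⟩ := exists_unitary_comp_isPositive_eq X
  rw [← hX, ← LinearMap.comp_assoc, ← Complex.ofReal_re (traceNorm X), ← htr]
  exact norm_trace_comp_le_of_isPositive (fun x => (hC _).trans (W.norm_map x).le) hS

theorem fid_nonneg (A B : M →L[ℂ] M) : 0 ≤ fid A B :=
  (norm_nonneg _).trans (norm_trace_comp_le_traceNorm (C := LinearMap.id) (fun _ => le_rfl) _)

theorem exists_unitary_trace_comp_eq_traceNorm (X : M →L[ℂ] M) : ∃ W : M ≃ₗᵢ[ℂ] M,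
    LinearMap.trace ℂ M (W.toLinearEquiv.toLinearMap ∘ₗ X.toLinearMap) = traceNorm X := by
  obtain ⟨W, S, -, hX, htr⟩ := exists_unitary_comp_isPositive_eq X
  refine ⟨W.symm, ?_⟩
  rw [← htr, ← hX]
  exact congrArg _ (LinearMap.ext fun x => W.symm_apply_apply (S x))

theorem traceNorm_le_of_eq_comp {X : M →L[ℂ] M} {Z : N →L[ℂ] N} {Q : N →ₗ[ℂ] M}
    {R : M →ₗ[ℂ] N} (hQ : ∀ x, ‖Q x‖ ≤ ‖x‖) (hR : ∀ x, ‖R x‖ ≤ ‖x‖)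
    (h : X.toLinearMap = Q ∘ₗ Z.toLinearMap ∘ₗ R) : traceNorm X ≤ traceNorm Z := by
  obtain ⟨W, hW⟩ := exists_unitary_trace_comp_eq_traceNorm X
  have htr : (traceNorm X : ℂ) = LinearMap.trace ℂ N
      ((R ∘ₗ W.toLinearEquiv.toLinearMap ∘ₗ Q) ∘ₗ Z.toLinearMap) := by
    rw [← hW, h]
    exact LinearMap.trace_comp_comm' R (W.toLinearEquiv.toLinearMap ∘ₗ Q ∘ₗ Z.toLinearMap)
  calc traceNorm X ≤ ‖(traceNorm X : ℂ)‖ := (le_abs_self _).trans_eq (Complex.norm_real _).symm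
    _ ≤ traceNorm Z := htr ▸ norm_trace_comp_le_traceNorm
      (fun x => (hR _).trans ((W.norm_map _).le.trans (hQ x))) Z

theorem fid_eq_traceNorm_adjoint_comp {F₁ F₂ : M →L[ℂ] M} {A B : N →ₗ[ℂ] M}
    (h₁ : F₁.toLinearMap = A ∘ₗ LinearMap.adjoint A)
    (h₂ : F₂.toLinearMap = B ∘ₗ LinearMap.adjoint B) :
    fid F₁ F₂ = traceNorm (LinearMap.toContinuousLinearMap (LinearMap.adjoint A ∘ₗ B)) := by
  have polar : ∀ {F : M →L[ℂ] M} {K : N →ₗ[ℂ] M}, F.toLinearMap = K ∘ₗ LinearMap.adjoint K →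
      ∃ T : M →ₗ[ℂ] N, (∀ x, ‖T x‖ ≤ ‖x‖) ∧
        T ∘ₗ (opSqrt F).toLinearMap = LinearMap.adjoint K ∧
        LinearMap.adjoint T ∘ₗ LinearMap.adjoint K = (opSqrt F).toLinearMap :=
    fun {F K} h => exists_contraction_comp_eq_of_norm_eq _ _ fun x =>
      (norm_opSqrt_apply_of_eq_adjoint_comp (by rw [h, LinearMap.adjoint_adjoint]) x).symm
  obtain ⟨S, hS, hSF, hSA⟩ := polar h₁
  obtain ⟨T, hT, hTF, hTB⟩ := polar h₂
  have hFT : (opSqrt F₂).toLinearMap ∘ₗ LinearMap.adjoint T = B := by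
    rw [← adjoint_opSqrt, ← LinearMap.adjoint_comp, hTF, LinearMap.adjoint_adjoint]
  have hBT : B ∘ₗ T = (opSqrt F₂).toLinearMap := by
    rw [← adjoint_opSqrt, ← hTB, LinearMap.adjoint_comp, LinearMap.adjoint_adjoint,
      LinearMap.adjoint_adjoint]
  refine le_antisymm (traceNorm_le_of_eq_comp (norm_adjoint_apply_le hS) hT ?_)
    (traceNorm_le_of_eq_comp hS (norm_adjoint_apply_le hT) ?_)
  · rw [ContinuousLinearMap.toLinearMap_comp, ← hSA, ← hBT]
    rfl
  · rw [ContinuousLinearMap.toLinearMap_comp, LinearMap.comp_assoc, hFT, ← LinearMap.comp_assoc,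
      hSF]
    rfl

end TraceNorm

section Purification

variable {M N : Type*} [NormedAddCommGroup M] [InnerProductSpace ℂ M]
  [NormedAddCommGroup N] [InnerProductSpace ℂ N]

theorem nonempty_antiunitary (N : Type*) [NormedAddCommGroup N] [InnerProductSpace ℂ N]
    [FiniteDimensional ℂ N] : Nonempty (N ≃ₗᵢ⋆[ℂ] N) := by
  let e := stdOrthonormalBasis ℂ N
  let conj : EuclideanSpace ℂ (Fin (Module.finrank ℂ N)) ≃ₗᵢ⋆[ℂ]
      EuclideanSpace ℂ (Fin (Module.finrank ℂ N)) :=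
    { toFun x := WithLp.toLp 2 (star x.ofLp)
      invFun x := WithLp.toLp 2 (star x.ofLp)
      map_add' x y := by simp
      map_smul' c x := by simp
      left_inv x := by simp
      right_inv x := by simp
      norm_map' x := by simp [EuclideanSpace.norm_eq] }
  exact ⟨e.repr.trans (conj.trans e.repr.symm)⟩

theorem inner_antiunitary_apply (J : N ≃ₗᵢ⋆[ℂ] N) (x y : N) :
    inner ℂ (J x) (J y) = inner ℂ y x := by
  have norm_add_I_smul (u v : N) : ‖u + Complex.I • v‖ = ‖v - Complex.I • u‖ := by
    have h : u + Complex.I • v = Complex.I • (v - Complex.I • u) := by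
      rw [smul_sub, smul_smul, Complex.I_mul_I, neg_one_smul, sub_neg_eq_add, add_comm]
    rw [h, norm_smul, Complex.norm_I, one_mul]
  have hJ_add : J x + Complex.I • J y = J (x - Complex.I • y) := by simp [map_smulₛₗ]
  have hJ_sub : J x - Complex.I • J y = J (x + Complex.I • y) := by
    simp [map_smulₛₗ, sub_eq_add_neg]
  simp only [inner_eq_sum_norm_sq_div_four, RCLike.I_to_complex, hJ_add, hJ_sub, ← map_add,
    ← map_sub, J.norm_map, ← norm_add_I_smul, add_comm y x, norm_sub_rev y x]

/-- The operator `N → M` of a bipartite vector `φ : M ⊗ N`, given by `m ⊗ n ↦ |m⟩⟨J n|`; the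
antiunitary `J` makes it linear in `φ`. -/
def bipartiteOp (J : N ≃ₗᵢ⋆[ℂ] N) : M ⊗[ℂ] N →ₗ[ℂ] N →ₗ[ℂ] M :=
  TensorProduct.lift (LinearMap.mk₂ ℂ
    (fun m n => (InnerProductSpace.rankOne ℂ m (J n)).toLinearMap)
    (fun m m' n => by simp) (fun c m n => by simp) (fun m n n' => by simp)
    (fun c m n => by simp [map_smulₛₗ]))

theorem bipartiteOp_tmul (J : N ≃ₗᵢ⋆[ℂ] N) (m : M) (n : N) :
    bipartiteOp J (m ⊗ₜ[ℂ] n) = (InnerProductSpace.rankOne ℂ m (J n)).toLinearMap :=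
  rfl

theorem toLinearMap_rankOne_tmul (m m' : M) (n n' : N) :
    (InnerProductSpace.rankOne ℂ (m ⊗ₜ[ℂ] n) (m' ⊗ₜ[ℂ] n')).toLinearMap
      = TensorProduct.map (InnerProductSpace.rankOne ℂ m m').toLinearMap
          (InnerProductSpace.rankOne ℂ n n').toLinearMap := by
  ext x y
  simp [mul_smul, smul_comm (inner ℂ m' x), TensorProduct.smul_tmul']

variable [FiniteDimensional ℂ M] [FiniteDimensional ℂ N]

theorem adjoint_toLinearMap_rankOne (m : M) (n : N) :
    LinearMap.adjoint (InnerProductSpace.rankOne ℂ m n).toLinearMap =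
      (InnerProductSpace.rankOne ℂ n m).toLinearMap :=
  ((LinearMap.eq_adjoint_iff _ _).2 fun x y => by
    simp [inner_smul_left, inner_smul_right, mul_comm]).symm

theorem partialTrace_rankOne (J : N ≃ₗᵢ⋆[ℂ] N) (φ φ' : M ⊗[ℂ] N) :
    partialTrace (InnerProductSpace.rankOne ℂ φ φ').toLinearMap =
      bipartiteOp J φ ∘ₗ LinearMap.adjoint (bipartiteOp J φ') := by
  induction φ with
  | zero => simp
  | add x y hx hy => simp [hx, hy, LinearMap.add_comp]
  | tmul m n =>
    induction φ' with
    | zero => simp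
    | add x y hx hy => simp [hx, hy, LinearMap.comp_add]
    | tmul m' n' =>
      rw [toLinearMap_rankOne_tmul, partialTrace_map, InnerProductSpace.trace_rankOne,
        bipartiteOp_tmul, bipartiteOp_tmul, adjoint_toLinearMap_rankOne]
      ext x
      simp [inner_antiunitary_apply, smul_smul, mul_comm]

theorem inner_lTensor_eq_trace (J : N ≃ₗᵢ⋆[ℂ] N) (Y : N →ₗ[ℂ] N) (φ φ' : M ⊗[ℂ] N) :
    inner ℂ (Y.lTensor M φ) φ' = LinearMap.trace ℂ N
      ((J.toLinearEquiv.toLinearMap ∘ₛₗ Y ∘ₛₗ J.symm.toLinearEquiv.toLinearMap) ∘ₗ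
        LinearMap.adjoint (bipartiteOp J φ) ∘ₗ bipartiteOp J φ') := by
  induction φ with
  | zero => simp
  | add x y hx hy => simp [hx, hy, LinearMap.comp_add, inner_add_left, LinearMap.add_comp]
  | tmul m n =>
    induction φ' with
    | zero => simp
    | add x y hx hy =>
      rw [inner_add_right, hx, hy, map_add, LinearMap.comp_add, LinearMap.comp_add, map_add]
    | tmul m' n' =>
      rw [bipartiteOp_tmul, bipartiteOp_tmul, adjoint_toLinearMap_rankOne]
      have h : (J.toLinearEquiv.toLinearMap ∘ₛₗ Y ∘ₛₗ J.symm.toLinearEquiv.toLinearMap) ∘ₗ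
          (InnerProductSpace.rankOne ℂ (J n) m).toLinearMap ∘ₗ
            (InnerProductSpace.rankOne ℂ m' (J n')).toLinearMap =
          inner ℂ m m' • (InnerProductSpace.rankOne ℂ (J (Y n)) (J n')).toLinearMap := by
        ext x
        simp [map_smulₛₗ, smul_smul, mul_comm]
      rw [h, map_smul, InnerProductSpace.trace_rankOne, inner_antiunitary_apply,
        LinearMap.lTensor_tmul, TensorProduct.inner_tmul, smul_eq_mul]

theorem norm_inner_lTensor_le_fid {Y : N →ₗ[ℂ] N} (hY : ∀ n, ‖Y n‖ ≤ ‖n‖) {φ₁ φ₂ : M ⊗[ℂ] N}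
    {F₁ F₂ : M →L[ℂ] M}
    (h₁ : F₁.toLinearMap = partialTrace (InnerProductSpace.rankOne ℂ φ₁ φ₁).toLinearMap)
    (h₂ : F₂.toLinearMap = partialTrace (InnerProductSpace.rankOne ℂ φ₂ φ₂).toLinearMap) :
    ‖inner ℂ (Y.lTensor M φ₁) φ₂‖ ≤ fid F₁ F₂ := by
  obtain ⟨J⟩ := nonempty_antiunitary N
  rw [partialTrace_rankOne J] at h₁ h₂
  rw [fid_eq_traceNorm_adjoint_comp h₁ h₂, inner_lTensor_eq_trace J Y]
  exact norm_trace_comp_le_traceNorm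
    (C := J.toLinearEquiv.toLinearMap ∘ₛₗ Y ∘ₛₗ J.symm.toLinearEquiv.toLinearMap)
    (fun n => (J.norm_map _).trans_le ((hY _).trans_eq (J.symm.norm_map n)))
    (LinearMap.toContinuousLinearMap (LinearMap.adjoint (bipartiteOp J φ₁) ∘ₗ bipartiteOp J φ₂))

theorem exists_unitary_inner_lTensor_eq_fid {φ₁ φ₂ : M ⊗[ℂ] N} {F₁ F₂ : M →L[ℂ] M}
    (h₁ : F₁.toLinearMap = partialTrace (InnerProductSpace.rankOne ℂ φ₁ φ₁).toLinearMap)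
    (h₂ : F₂.toLinearMap = partialTrace (InnerProductSpace.rankOne ℂ φ₂ φ₂).toLinearMap) :
    ∃ Y : N ≃ₗᵢ[ℂ] N, inner ℂ (Y.toLinearEquiv.toLinearMap.lTensor M φ₁) φ₂ = fid F₁ F₂ := by
  obtain ⟨J⟩ := nonempty_antiunitary N
  rw [partialTrace_rankOne J] at h₁ h₂
  obtain ⟨W, hW⟩ := exists_unitary_trace_comp_eq_traceNorm
    (LinearMap.toContinuousLinearMap (LinearMap.adjoint (bipartiteOp J φ₁) ∘ₗ bipartiteOp J φ₂))
  refine ⟨(J.trans W).trans J.symm, ?_⟩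
  rw [fid_eq_traceNorm_adjoint_comp h₁ h₂, ← hW, inner_lTensor_eq_trace J]
  congr 2
  ext n
  simp

end Purification

section Intertwiners

variable {G H M N : Type*} [Group G]
  [NormedAddCommGroup H] [InnerProductSpace ℂ H] {U : G →* (H ≃ₗᵢ[ℂ] H)}
  [NormedAddCommGroup M] [InnerProductSpace ℂ M] {ρ : G →* (M ≃ₗᵢ[ℂ] M)}
  [NormedAddCommGroup N] [InnerProductSpace ℂ N] {σ : G →* (N ≃ₗᵢ[ℂ] N)}

theorem inner_apply_left (U : G →* (H ≃ₗᵢ[ℂ] H)) (g : G) (x y : H) :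
    inner ℂ (U g x) y = inner ℂ x (U g⁻¹ y) := by
  rw [map_inv]
  exact (U g).inner_map_eq_flip x y

theorem exists_norm_eq_one_of_isIrreducible (ρ : G →* (M ≃ₗᵢ[ℂ] M))
    [(toRepresentation ρ).IsIrreducible] : ∃ m : M, ‖m‖ = 1 := by
  have : Nontrivial M := by
    by_contra h
    rw [not_nontrivial_iff_subsingleton] at h
    exact bot_ne_top (α := Subrepresentation (toRepresentation ρ))
      (Subrepresentation.toSubmodule_injective (Subsingleton.elim _ _))
  exact exists_norm_eq M zero_le_one

/-- The intertwiners `ρ → U` of two unitary representations. -/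
abbrev Intertwiner (ρ : G →* (M ≃ₗᵢ[ℂ] M)) (U : G →* (H ≃ₗᵢ[ℂ] H)) : Type _ :=
  (toRepresentation ρ).IntertwiningMap (toRepresentation U)

/-- A `G`-invariant unitary, regarded as a self-intertwiner. -/
def IsGInvariant.toIntertwiner {V : H ≃ₗᵢ[ℂ] H} (hV : IsGInvariant U V) : Intertwiner U U :=
  V.toLinearEquiv.toLinearMap.intertwiningMap_of_isIntertwiningMap _ _ fun g x =>
    DFunLike.congr_fun (hV g) x

namespace Intertwiner

theorem map_apply (f : Intertwiner ρ U) (g : G) (m : M) : f (ρ g m) = U g (f m) :=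
  Representation.IntertwiningMap.isIntertwining _ _ f g m

theorem eval_injective [(toRepresentation ρ).IsIrreducible] {m₀ : M} (hm₀ : m₀ ≠ 0) :
    Function.Injective fun f : Intertwiner ρ U => f m₀ := fun f f' h => by
  refine sub_eq_zero.1 ((Representation.IsIrreducible.injective_or_eq_zero (f - f')).resolve_left
    fun hinj => hm₀ (hinj ?_))
  rw [map_zero]
  exact sub_eq_zero.2 h

variable [FiniteDimensional ℂ M] [FiniteDimensional ℂ H]

/-- The Hilbert space adjoint of an intertwiner of unitary representations. -/
def adjoint (f : Intertwiner ρ U) : Intertwiner U ρ :=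
  (LinearMap.adjoint f.toLinearMap).intertwiningMap_of_isIntertwiningMap _ _ fun g x =>
    ext_inner_right ℂ fun m =>
      calc inner ℂ (LinearMap.adjoint f.toLinearMap (U g x)) m
          = inner ℂ (U g x) (f m) := LinearMap.adjoint_inner_left _ _ _
        _ = inner ℂ x (f (ρ g⁻¹ m)) := by rw [inner_apply_left, f.map_apply]
        _ = inner ℂ (LinearMap.adjoint f.toLinearMap x) (ρ g⁻¹ m) :=
          (LinearMap.adjoint_inner_left _ _ _).symm
        _ = inner ℂ (ρ g (LinearMap.adjoint f.toLinearMap x)) m := (inner_apply_left _ _ _ _).symm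

theorem inner_adjoint_right (f : Intertwiner ρ U) (m : M) (x : H) :
    inner ℂ m (f.adjoint x) = inner ℂ (f m) x :=
  LinearMap.adjoint_inner_right f.toLinearMap m x

variable [(toRepresentation ρ).IsIrreducible]

/-- By Schur's lemma `f† f' = 0`. -/
theorem inner_apply_apply_eq_zero [(toRepresentation σ).IsIrreducible]
    (h : IsEmpty ((toRepresentation σ).Equiv (toRepresentation ρ)))
    (f : Intertwiner ρ U) (f' : Intertwiner σ U) (m : M) (n : N) :
    inner ℂ (f m) (f' n) = 0 := by
  have hff' : f.adjoint.comp f' = (0 : Intertwiner σ ρ) := Subsingleton.elim _ _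
  rw [← inner_adjoint_right, ← Representation.IntertwiningMap.comp_apply, hff']
  exact inner_zero_right m

/-- By Schur's lemma `f† f'` is a scalar, which is read off at the unit vector `m₀`. -/
theorem inner_apply_apply (f f' : Intertwiner ρ U) {m₀ : M} (hm₀ : ‖m₀‖ = 1) (m m' : M) :
    inner ℂ (f m) (f' m') = inner ℂ (f m₀) (f' m₀) * inner ℂ m m' := by
  obtain ⟨c, hc⟩ :=
    (Representation.IsIrreducible.algebraMap_intertwiningMap_bijective_of_isAlgClosed
      (ρ := toRepresentation ρ)).2 (f.adjoint.comp f')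
  have inner_eq (a b : M) : inner ℂ (f a) (f' b) = c * inner ℂ a b := by
    rw [← inner_adjoint_right, ← Representation.IntertwiningMap.comp_apply, ← hc]
    exact inner_smul_right _ _ _
  rw [inner_eq m₀, inner_self_eq_one_of_norm_eq_one hm₀, mul_one, inner_eq]

end Intertwiner

end Intertwiners

namespace IrrepDecomposition

variable {G H : Type*} [Group G] [NormedAddCommGroup H] [InnerProductSpace ℂ H]
  {U : G →* (H ≃ₗᵢ[ℂ] H)} (D : IrrepDecomposition U)

instance (μ : D.Index) : (toRepresentation (D.irrep μ)).IsIrreducible :=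
  D.irreducible μ

/-- The isometric identification of `⨁_μ M_μ ⊗ N_μ` with `H`. -/
def directSumEquiv : PiLp 2 (fun μ => D.M μ ⊗[ℂ] D.N μ) ≃ₗᵢ[ℂ] H :=
  let E : PiLp 2 (fun μ => D.M μ ⊗[ℂ] D.N μ) →ₗ[ℂ] H :=
    ∑ μ, (D.incl μ).toLinearMap ∘ₗ PiLp.projₗ 2 _ μ
  have hE (x) : E x = ∑ μ, D.incl μ (x μ) := by simp [E]
  have hE_range : LinearMap.range E = ⊤ := by
    classical
    rw [eq_top_iff, ← D.iSup_range, iSup_le_iff]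
    rintro μ _ ⟨y, rfl⟩
    refine ⟨PiLp.single 2 μ y, ?_⟩
    rw [hE, Finset.sum_eq_single μ (fun ν _ h => by rw [PiLp.single_eq_of_ne 2 h, map_zero])
      (by simp), PiLp.single_eq_same]
    rfl
  LinearIsometryEquiv.ofSurjective
    ⟨E, fun x => by
      rw [← sq_eq_sq₀ (norm_nonneg _) (norm_nonneg _), hE, D.orthogonal.norm_sum,
        PiLp.norm_sq_eq_of_L2]⟩
    (LinearMap.range_eq_top.1 hE_range)

theorem directSumEquiv_apply (x : PiLp 2 (fun μ => D.M μ ⊗[ℂ] D.N μ)) :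
    D.directSumEquiv x = ∑ μ, D.incl μ (x μ) := by
  simp [directSumEquiv]

/-- The component of a vector in the summand `M_μ ⊗ N_μ`. -/
def component (μ : D.Index) : H →ₗ[ℂ] D.M μ ⊗[ℂ] D.N μ :=
  PiLp.projₗ 2 _ μ ∘ₗ D.directSumEquiv.symm.toLinearEquiv.toLinearMap

theorem sum_incl_component (x : H) : ∑ μ, D.incl μ (D.component μ x) = x :=
  (D.directSumEquiv_apply _).symm.trans (D.directSumEquiv.apply_symm_apply x)

theorem component_sum_incl (x : ∀ μ, D.M μ ⊗[ℂ] D.N μ) (μ : D.Index) :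
    D.component μ (∑ ν, D.incl ν (x ν)) = x μ := by
  rw [← D.directSumEquiv_apply (WithLp.toLp 2 x)]
  simp [component]

theorem inner_eq_sum_inner_component (x y : H) :
    inner ℂ x y = ∑ μ, inner ℂ (D.component μ x) (D.component μ y) :=
  (D.directSumEquiv.symm.inner_map_map x y).symm

theorem inner_component_right (μ : D.Index) (y : D.M μ ⊗[ℂ] D.N μ) (x : H) :
    inner ℂ y (D.component μ x) = inner ℂ (D.incl μ y) x := by
  conv_rhs => rw [← D.sum_incl_component x]
  exact (D.orthogonal.inner_right_fintype _ μ y).symm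

theorem apply_incl (g : G) (μ : D.Index) (y : D.M μ ⊗[ℂ] D.N μ) :
    U g (D.incl μ y) = D.incl μ ((toRepresentation (D.irrep μ) g).rTensor (D.N μ) y) := by
  induction y with
  | zero => simp
  | tmul m n => exact D.map_incl g μ m n
  | add x y hx hy => simp only [map_add, hx, hy]

theorem component_apply (g : G) (μ : D.Index) (x : H) :
    D.component μ (U g x) =
      (toRepresentation (D.irrep μ) g).rTensor (D.N μ) (D.component μ x) := by
  conv_lhs => rw [← D.sum_incl_component x, map_sum]
  simp only [apply_incl]
  exact D.component_sum_incl _ μ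

theorem pureReduction_eq [FiniteDimensional ℂ H] (ψ : H) (μ : D.Index) :
    (D.pureReduction ψ μ).toLinearMap = partialTrace
      (InnerProductSpace.rankOne ℂ (D.component μ ψ) (D.component μ ψ)).toLinearMap := by
  have proj_incl (y) : D.proj μ (D.incl μ y) = D.incl μ y :=
    Submodule.starProjection_eq_self_iff.2 (LinearMap.mem_range_self (D.incl μ).toLinearMap y)
  have inner_incl_proj (y) (x : H) :
      inner ℂ (D.incl μ y) (D.proj μ x) = inner ℂ (D.incl μ y) x := by
    conv_rhs => rw [← proj_incl]
    exact (Submodule.inner_starProjection_left_eq_right _ _ _).symm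
  rw [pureReduction, reduction]
  refine congrArg partialTrace (LinearMap.ext fun y => ext_inner_left ℂ fun z => ?_)
  rw [LinearMap.comp_apply, LinearMap.adjoint_inner_right]
  refine (inner_incl_proj z _).trans ?_
  simp only [LinearMap.comp_apply, LinearIsometry.coe_toLinearMap, proj_incl,
    ContinuousLinearMap.coe_coe, InnerProductSpace.rankOne_apply, inner_smul_right,
    inner_component_right]
  rw [← inner_conj_symm ψ, ← inner_component_right]
  congr 1
  exact inner_conj_symm (D.component μ ψ) y

/-- The intertwiner `m ↦ m ⊗ n` from the irrep `U_μ` into `U`. -/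
def inclTmul (μ : D.Index) (n : D.N μ) : Intertwiner (D.irrep μ) U :=
  ((D.incl μ).toLinearMap ∘ₗ (TensorProduct.mk ℂ (D.M μ) (D.N μ)).flip n
    ).intertwiningMap_of_isIntertwiningMap _ _ fun g m => (D.map_incl g μ m n).symm

section Invariant

variable [FiniteDimensional ℂ H] (V : Intertwiner U U)

theorem component_apply_incl_of_ne {μ ν : D.Index} (h : μ ≠ ν) (y : D.M μ ⊗[ℂ] D.N μ) :
    D.component ν (V (D.incl μ y)) = 0 := by
  induction y with
  | zero => simp
  | add x y hx hy => rw [map_add, map_add, map_add, hx, hy, add_zero]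
  | tmul m n =>
    refine TensorProduct.ext_iff_inner_left.2 fun m' n' => ?_
    rw [inner_component_right, inner_zero_right]
    exact Intertwiner.inner_apply_apply_eq_zero (D.inequivalent μ ν h) (D.inclTmul ν n')
      (V.comp (D.inclTmul μ n)) m' m

variable {V}

theorem exists_component_apply_incl_eq (hV : ∀ x, ‖V x‖ ≤ ‖x‖) (μ : D.Index) :
    ∃ Y : D.N μ →ₗ[ℂ] D.N μ, (∀ n, ‖Y n‖ ≤ ‖n‖) ∧
      ∀ y, D.component μ (V (D.incl μ y)) = Y.lTensor (D.M μ) y := by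
  obtain ⟨m₀, hm₀⟩ := exists_norm_eq_one_of_isIrreducible (D.irrep μ)
  let ι : D.N μ →ₗ[ℂ] H := (D.incl μ).toLinearMap ∘ₗ TensorProduct.mk ℂ (D.M μ) (D.N μ) m₀
  have hι (n) : ‖ι n‖ = ‖n‖ := by simp [ι, hm₀]
  refine ⟨LinearMap.adjoint ι ∘ₗ V.toLinearMap ∘ₗ ι, fun n => ?_, fun y => ?_⟩
  · exact (norm_adjoint_apply_le (fun n => (hι n).le) _).trans ((hV _).trans_eq (hι n))
  induction y with
  | zero => simp
  | add x y hx hy => simp only [map_add, hx, hy]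
  | tmul m n =>
    refine TensorProduct.ext_iff_inner_left.2 fun m' n' => ?_
    rw [inner_component_right, LinearMap.lTensor_tmul, TensorProduct.inner_tmul,
      LinearMap.comp_apply, LinearMap.adjoint_inner_right, mul_comm]
    exact Intertwiner.inner_apply_apply (D.inclTmul μ n') (V.comp (D.inclTmul μ n)) hm₀ m' m

theorem exists_component_apply_eq_lTensor (hV : ∀ x, ‖V x‖ ≤ ‖x‖) (μ : D.Index) :
    ∃ Y : D.N μ →ₗ[ℂ] D.N μ, (∀ n, ‖Y n‖ ≤ ‖n‖) ∧
      ∀ x, D.component μ (V x) = Y.lTensor (D.M μ) (D.component μ x) := by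
  obtain ⟨Y, hY, hVY⟩ := D.exists_component_apply_incl_eq hV μ
  refine ⟨Y, hY, fun x => ?_⟩
  conv_lhs => rw [← D.sum_incl_component x, map_sum, map_sum]
  rw [Finset.sum_eq_single μ (fun ν _ h => D.component_apply_incl_of_ne V h _) (by simp), hVY]

theorem norm_inner_le_sum_fid (hV : ∀ x, ‖V x‖ ≤ ‖x‖) (ψ₁ ψ₂ : H) :
    ‖inner ℂ ψ₂ (V ψ₁)‖ ≤ ∑ μ, fid (D.pureReduction ψ₁ μ) (D.pureReduction ψ₂ μ) := by
  choose Y hY hVY using D.exists_component_apply_eq_lTensor hV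
  rw [norm_inner_symm, D.inner_eq_sum_inner_component]
  refine norm_sum_le_of_le _ fun μ _ => ?_
  rw [hVY]
  exact norm_inner_lTensor_le_fid (hY μ) (D.pureReduction_eq ψ₁ μ) (D.pureReduction_eq ψ₂ μ)

end Invariant

/-- The unitary `⨁_μ 1 ⊗ Y_μ` on `H`. -/
def multiplicityUnitary (Y : ∀ μ, D.N μ ≃ₗᵢ[ℂ] D.N μ) : H ≃ₗᵢ[ℂ] H :=
  (D.directSumEquiv.symm.trans
    (LinearIsometryEquiv.piLpCongrRight 2 fun μ => (Y μ).lTensor (D.M μ))).trans D.directSumEquiv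

theorem multiplicityUnitary_apply (Y : ∀ μ, D.N μ ≃ₗᵢ[ℂ] D.N μ) (x : H) :
    D.multiplicityUnitary Y x =
      ∑ μ, D.incl μ ((Y μ).toLinearEquiv.toLinearMap.lTensor (D.M μ) (D.component μ x)) :=
  D.directSumEquiv_apply _

theorem isGInvariant_multiplicityUnitary (Y : ∀ μ, D.N μ ≃ₗᵢ[ℂ] D.N μ) :
    IsGInvariant U (D.multiplicityUnitary Y) := by
  refine fun g => LinearIsometryEquiv.ext fun x => ?_
  change D.multiplicityUnitary Y (U g x) = U g (D.multiplicityUnitary Y x)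
  simp only [multiplicityUnitary_apply, map_sum, apply_incl, component_apply]
  refine Finset.sum_congr rfl fun μ _ => congrArg (D.incl μ) ?_
  rw [← LinearMap.comp_apply, LinearMap.lTensor_comp_rTensor, ← LinearMap.rTensor_comp_lTensor,
    LinearMap.comp_apply]

theorem exists_isGInvariant_norm_inner_eq [FiniteDimensional ℂ H] (ψ₁ ψ₂ : H) :
    ∃ V : H ≃ₗᵢ[ℂ] H, IsGInvariant U V ∧
      ‖inner ℂ ψ₂ (V ψ₁)‖ = ∑ μ, fid (D.pureReduction ψ₁ μ) (D.pureReduction ψ₂ μ) := by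
  choose Y hY using fun μ =>
    exists_unitary_inner_lTensor_eq_fid (D.pureReduction_eq ψ₁ μ) (D.pureReduction_eq ψ₂ μ)
  refine ⟨D.multiplicityUnitary Y, D.isGInvariant_multiplicityUnitary Y, ?_⟩
  have h : inner ℂ (D.multiplicityUnitary Y ψ₁) ψ₂ =
      ((∑ μ, fid (D.pureReduction ψ₁ μ) (D.pureReduction ψ₂ μ) : ℝ) : ℂ) := by
    rw [D.inner_eq_sum_inner_component, Complex.ofReal_sum]
    refine Finset.sum_congr rfl fun μ _ => ?_
    rw [multiplicityUnitary_apply, component_sum_incl, hY]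
  rw [norm_inner_symm, h, Complex.norm_of_nonneg (Finset.sum_nonneg fun μ _ => fid_nonneg _ _)]

end IrrepDecomposition

/-- Orthonormal coordinates on a finite-dimensional Hilbert space, indexed so as to live in a
prescribed universe. -/
def uliftCoordinates (K : Type*) [NormedAddCommGroup K] [InnerProductSpace ℂ K]
    [FiniteDimensional ℂ K] :
    EuclideanSpace ℂ (ULift.{w} (Fin (Module.finrank ℂ K))) ≃ₗᵢ[ℂ] K :=
  ((stdOrthonormalBasis ℂ K).reindex Equiv.ulift.symm).repr.symm

section Isotypic

variable {G H M N : Type*} [Group G]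
  [NormedAddCommGroup H] [InnerProductSpace ℂ H] {U : G →* (H ≃ₗᵢ[ℂ] H)}
  [NormedAddCommGroup M] [InnerProductSpace ℂ M] {ρ : G →* (M ≃ₗᵢ[ℂ] M)}
  [NormedAddCommGroup N] [InnerProductSpace ℂ N] {σ : G →* (N ≃ₗᵢ[ℂ] N)}

/-- The isotypic component of `ρ` in `U`: the subrepresentation generated by the images of all
intertwiners. -/
def isotypic (ρ : G →* (M ≃ₗᵢ[ℂ] M)) (U : G →* (H ≃ₗᵢ[ℂ] H)) :
    Subrepresentation (toRepresentation U) where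
  toSubmodule := ⨆ f : Intertwiner ρ U, LinearMap.range f.toLinearMap
  apply_mem_toSubmodule g :=
    (iSup_le fun f => by
      rintro _ ⟨m, rfl⟩
      exact Submodule.mem_iSup_of_mem f ⟨ρ g m, f.map_apply g m⟩ :
      _ ≤ (⨆ f : Intertwiner ρ U, LinearMap.range f.toLinearMap).comap (toRepresentation U g))

theorem apply_mem_isotypic (f : Intertwiner ρ U) (m : M) : f m ∈ isotypic ρ U :=
  Submodule.mem_iSup_of_mem f ⟨m, rfl⟩

theorem isotypic_mono_of_equiv (e : (toRepresentation σ).Equiv (toRepresentation ρ)) :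
    isotypic ρ U ≤ isotypic σ U := by
  refine (iSup_le fun f => ?_ : (isotypic ρ U).toSubmodule ≤ (isotypic σ U).toSubmodule)
  rintro _ ⟨m, rfl⟩
  obtain ⟨n, rfl⟩ := e.surjective m
  exact apply_mem_isotypic (f.comp e.toIntertwiningMap) n

section TensorEval

variable {K : Type*} [NormedAddCommGroup K] [InnerProductSpace ℂ K]

/-- The map `M ⊗ K → H`, `m ⊗ k ↦ s k m`, attached to a linear family `s` of intertwiners
parametrized by `K`. -/
def tensorEval (s : K →ₗ[ℂ] Intertwiner ρ U) : M ⊗[ℂ] K →ₗ[ℂ] H :=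
  TensorProduct.lift (LinearMap.mk₂ ℂ (fun m k => s k m) (fun _ _ _ => map_add _ _ _)
    (fun _ _ _ => map_smul _ _ _) (fun m k k' => by rw [map_add]; rfl)
    (fun c m k => by rw [map_smul]; rfl))

theorem range_tensorEval {s : K →ₗ[ℂ] Intertwiner ρ U} (hs : Function.Surjective s) :
    LinearMap.range (tensorEval s) = (isotypic ρ U).toSubmodule := by
  refine le_antisymm ?_ (iSup_le fun f => ?_)
  · rintro _ ⟨y, rfl⟩
    induction y with
    | zero => simp
    | add x y hx hy => rw [map_add]; exact add_mem hx hy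
    | tmul m k => exact apply_mem_isotypic (s k) m
  · rintro _ ⟨m, rfl⟩
    obtain ⟨k, rfl⟩ := hs f
    exact ⟨m ⊗ₜ[ℂ] k, rfl⟩

end TensorEval

variable [FiniteDimensional ℂ H] [FiniteDimensional ℂ M] [(toRepresentation ρ).IsIrreducible]

theorem isOrtho_isotypic [(toRepresentation σ).IsIrreducible]
    (h : IsEmpty ((toRepresentation σ).Equiv (toRepresentation ρ))) :
    (isotypic ρ U).toSubmodule ⟂ (isotypic σ U).toSubmodule := by
  refine Submodule.isOrtho_iSup_left.2 fun f => Submodule.isOrtho_iSup_right.2 fun f' => ?_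
  rw [Submodule.isOrtho_iff_inner_eq]
  rintro _ ⟨m, rfl⟩ _ ⟨n, rfl⟩
  exact f.inner_apply_apply_eq_zero h f' m n

theorem inner_tensorEval {K : Type*} [NormedAddCommGroup K] [InnerProductSpace ℂ K]
    {s : K →ₗ[ℂ] Intertwiner ρ U} {m₀ : M} (hm₀ : ‖m₀‖ = 1)
    (hs : ∀ k k', inner ℂ (s k m₀) (s k' m₀) = inner ℂ k k') (x y : M ⊗[ℂ] K) :
    inner ℂ (tensorEval s x) (tensorEval s y) = inner ℂ x y := by
  induction x with
  | zero => simp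
  | add x x' hx hx' => rw [map_add, inner_add_left, inner_add_left, hx, hx']
  | tmul m k =>
    induction y with
    | zero => simp
    | add y y' hy hy' => rw [map_add, inner_add_right, inner_add_right, hy, hy']
    | tmul m' k' =>
      refine (Intertwiner.inner_apply_apply (s k) (s k') hm₀ m m').trans ?_
      rw [hs, TensorProduct.inner_tmul, mul_comm]

variable (U ρ) in
theorem exists_isotypic_inclusion :
    ∃ (k : ℕ) (incl : (M ⊗[ℂ] EuclideanSpace ℂ (ULift.{w} (Fin k))) →ₗᵢ[ℂ] H),
      (∀ g m n, U g (incl (m ⊗ₜ[ℂ] n)) = incl (ρ g m ⊗ₜ[ℂ] n)) ∧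
      LinearMap.range incl.toLinearMap = (isotypic ρ U).toSubmodule := by
  obtain ⟨m₀, hm₀⟩ := exists_norm_eq_one_of_isIrreducible ρ
  let eval : Intertwiner ρ U →ₗ[ℂ] H :=
    { toFun f := f m₀, map_add' _ _ := rfl, map_smul' _ _ := rfl }
  have eval_injective : Function.Injective eval :=
    Intertwiner.eval_injective (ne_zero_of_norm_ne_zero (hm₀ ▸ one_ne_zero))
  let e := uliftCoordinates.{w} (LinearMap.range eval)
  let s := e.toLinearEquiv.trans (LinearEquiv.ofInjective eval eval_injective).symm
  have eval_s (n) : s n m₀ = e n :=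
    congrArg Subtype.val ((LinearEquiv.ofInjective eval eval_injective).apply_symm_apply (e n))
  have inner_s (n n') : inner ℂ (s n m₀) (s n' m₀) = inner ℂ n n' := by
    rw [eval_s, eval_s, ← Submodule.coe_inner, e.inner_map_map]
  exact ⟨_, (tensorEval s.toLinearMap).isometryOfInner (inner_tensorEval hm₀ inner_s),
    fun g m n => ((s n).map_apply g m).symm, range_tensorEval s.surjective⟩

end Isotypic

section CompleteReducibility

variable {G H : Type*} [Group G] [NormedAddCommGroup H] [InnerProductSpace ℂ H]
  {U : G →* (H ≃ₗᵢ[ℂ] H)}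

/-- The orthogonal complement of a subrepresentation of a unitary representation. -/
def orthogonalSubrep (T : Subrepresentation (toRepresentation U)) :
    Subrepresentation (toRepresentation U) where
  toSubmodule := T.toSubmoduleᗮ
  apply_mem_toSubmodule g x hx y hy := by
    change inner ℂ y (U g x) = 0
    rw [← inner_conj_symm, inner_apply_left, inner_conj_symm]
    exact hx _ (T.apply_mem_toSubmodule g⁻¹ hy)

theorem Intertwiner.isIrreducible_of_isAtom_range {M : Type*} [NormedAddCommGroup M]
    [InnerProductSpace ℂ M] {ρ : G →* (M ≃ₗᵢ[ℂ] M)} {f : Intertwiner ρ U}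
    (hf : Function.Injective f) (hrange : IsAtom f.range) :
    (toRepresentation ρ).IsIrreducible := by
  refine { exists_pair_ne := ⟨⊥, ⊤, fun h => ?_⟩, eq_bot_or_eq_top := fun S => ?_ }
  · refine hrange.1 (eq_bot_iff.2 ?_)
    rintro _ ⟨m, rfl⟩
    have hm : m ∈ (⊥ : Subrepresentation (toRepresentation ρ)) := h ▸ Submodule.mem_top
    exact congrArg f ((Submodule.mem_bot ℂ).1 hm) |>.trans (map_zero f)
  let image : Subrepresentation (toRepresentation U) :=
    { toSubmodule := S.toSubmodule.map f.toLinearMap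
      apply_mem_toSubmodule := by
        rintro g _ ⟨m, hm, rfl⟩
        exact ⟨ρ g m, S.apply_mem_toSubmodule g hm, f.map_apply g m⟩ }
  have image_le : image ≤ f.range := by
    rintro _ ⟨m, -, rfl⟩
    exact ⟨m, rfl⟩
  refine (hrange.le_iff.1 image_le).imp (fun h => ?_) fun h => ?_
  · refine Subrepresentation.toSubmodule_injective ((Submodule.eq_bot_iff _).2 fun m hm => ?_)
    have hfm : f m ∈ image := ⟨m, hm, rfl⟩
    rw [h] at hfm
    exact hf (((Submodule.mem_bot ℂ).1 hfm).trans (map_zero f).symm)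
  · refine Subrepresentation.toSubmodule_injective (Submodule.eq_top_iff'.2 fun m => ?_)
    obtain ⟨m', hm', hmm'⟩ : f m ∈ image := h ▸ ⟨m, rfl⟩
    exact hf hmm' ▸ hm'

variable [FiniteDimensional ℂ H]

instance : IsAtomic (Subrepresentation (toRepresentation U)) :=
  have : StrictMono (Subrepresentation.toSubmodule (ρ := toRepresentation U)) :=
    Monotone.strictMono_of_injective (fun _ _ h => h) Subrepresentation.toSubmodule_injective
  have := this.wellFoundedLT
  isAtomic_of_orderBot_wellFounded_lt wellFounded_lt

theorem eq_top_of_forall_isAtom_le {T : Subrepresentation (toRepresentation U)}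
    (hT : ∀ W, IsAtom W → W ≤ T) : T = ⊤ := by
  have hT_orthogonal : orthogonalSubrep T = ⊥ := by
    refine (eq_bot_or_exists_atom_le (orthogonalSubrep T)).resolve_right ?_
    rintro ⟨W, hW, hW_le⟩
    refine hW.1 (Subrepresentation.toSubmodule_injective ?_)
    exact Submodule.isOrtho_self.1 (Submodule.IsOrtho.mono (hT W hW) hW_le
      (Submodule.isOrtho_orthogonal_right _))
  refine Subrepresentation.toSubmodule_injective (Submodule.orthogonal_eq_bot_iff.1 ?_)
  exact congrArg Subrepresentation.toSubmodule hT_orthogonal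

variable (W : Subrepresentation (toRepresentation U))

/-- The unitary representation carried by a subrepresentation. -/
def restrict : G →* (W.toSubmodule ≃ₗᵢ[ℂ] W.toSubmodule) where
  toFun g :=
    { toLinearEquiv := LinearEquiv.ofLinearMap (W.toRepresentation g) (W.toRepresentation g⁻¹)
        (LinearMap.ext (W.toRepresentation.self_inv_apply g))
        (LinearMap.ext (W.toRepresentation.inv_self_apply g))
      norm_map' := fun x => (U g).norm_map x }
  map_one' := by ext x; exact congrArg (fun T => (T x : H)) (map_one W.toRepresentation)
  map_mul' g h := by ext x; exact congrArg (fun T => (T x : H)) (map_mul W.toRepresentation g h)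

/-- The matrix form of a subrepresentation, in orthonormal coordinates. -/
def coordinateRep :
    G →* (EuclideanSpace ℂ (ULift.{w} (Fin (Module.finrank ℂ W.toSubmodule))) ≃ₗᵢ[ℂ]
      EuclideanSpace ℂ (ULift.{w} (Fin (Module.finrank ℂ W.toSubmodule)))) where
  toFun g := ((uliftCoordinates W.toSubmodule).trans (restrict W g)).trans
    (uliftCoordinates W.toSubmodule).symm
  map_one' := by ext1 x; simp
  map_mul' g h := by ext1 x; simp

/-- The inclusion of a subrepresentation, read in orthonormal coordinates. -/
def coordinateIncl : Intertwiner (coordinateRep.{w} W) U :=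
  (W.toSubmodule.subtype ∘ₗ (uliftCoordinates.{w} W.toSubmodule).toLinearEquiv.toLinearMap
    ).intertwiningMap_of_isIntertwiningMap _ _ fun g x => congrArg Subtype.val
      ((uliftCoordinates.{w} W.toSubmodule).apply_symm_apply
        (restrict W g (uliftCoordinates W.toSubmodule x)))

theorem coordinateIncl_injective : Function.Injective (coordinateIncl.{w} W) :=
  Subtype.val_injective.comp (uliftCoordinates.{w} W.toSubmodule).injective

theorem range_coordinateIncl : (coordinateIncl.{w} W).range = W := by
  refine SetLike.ext fun x => ⟨?_, fun hx => ?_⟩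
  · rintro ⟨y, rfl⟩
    exact (uliftCoordinates.{w} W.toSubmodule y).2
  · exact ⟨(uliftCoordinates.{w} W.toSubmodule).symm ⟨x, hx⟩, congrArg Subtype.val
      ((uliftCoordinates.{w} W.toSubmodule).apply_symm_apply ⟨x, hx⟩)⟩

variable {W}

theorem isIrreducible_coordinateRep (hW : IsAtom W) :
    (toRepresentation (coordinateRep.{w} W)).IsIrreducible :=
  Intertwiner.isIrreducible_of_isAtom_range (coordinateIncl_injective W)
    ((range_coordinateIncl W).symm ▸ hW)

theorem le_isotypic_coordinateRep : W ≤ isotypic (coordinateRep.{w} W) U := by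
  conv_lhs => rw [← range_coordinateIncl.{w} W]
  rintro _ ⟨y, rfl⟩
  exact apply_mem_isotypic _ y

end CompleteReducibility

section Existence

variable {G : Type u} {H : Type v} [Group G] [NormedAddCommGroup H] [InnerProductSpace ℂ H]
  [FiniteDimensional ℂ H]

/-- The irreducible subrepresentations of `U`. -/
abbrev IrreducibleSubrep (U : G →* (H ≃ₗᵢ[ℂ] H)) : Type v :=
  {W : Subrepresentation (toRepresentation U) // IsAtom W}

namespace IrreducibleSubrep

variable {U : G →* (H ≃ₗᵢ[ℂ] H)}

instance (W : IrreducibleSubrep U) : (toRepresentation (coordinateRep.{w} W.1)).IsIrreducible :=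
  isIrreducible_coordinateRep W.2

/-- Equivalence of irreducible subrepresentations, stated for their coordinate forms because those
are the irreps of the decomposition. -/
instance setoid (U : G →* (H ≃ₗᵢ[ℂ] H)) : Setoid (IrreducibleSubrep U) where
  r W W' := Nonempty
    ((toRepresentation (coordinateRep.{w} W.1)).Equiv (toRepresentation (coordinateRep.{w} W'.1)))
  iseqv := ⟨fun _ => ⟨.refl _⟩, fun ⟨e⟩ => ⟨e.symm⟩, fun ⟨e⟩ ⟨e'⟩ => ⟨e.trans e'⟩⟩

theorem isEmpty_equiv_out {q q' : Quotient (setoid.{w} U)} (h : q ≠ q') :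
    IsEmpty ((toRepresentation (coordinateRep.{w} q.out.1)).Equiv
      (toRepresentation (coordinateRep.{w} q'.out.1))) :=
  not_nonempty_iff.1 fun hne => h (Quotient.out_equiv_out.1 hne)

instance finite_quotient : Finite (Quotient (setoid.{w} U)) := by
  choose m hm using fun q : Quotient (setoid.{w} U) =>
    exists_norm_eq_one_of_isIrreducible (coordinateRep.{w} q.out.1)
  have ortho : Pairwise fun q q' =>
      inner ℂ (coordinateIncl q.out.1 (m q)) (coordinateIncl q'.out.1 (m q')) = 0 :=
    fun q q' h => (coordinateIncl q.out.1).inner_apply_apply_eq_zero (isEmpty_equiv_out h.symm)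
      (coordinateIncl q'.out.1) (m q) (m q')
  refine (linearIndependent_of_ne_zero_of_inner_eq_zero (fun q => ?_) ortho).finite
  rw [Ne, map_eq_zero_iff _ (coordinateIncl_injective q.out.1)]
  exact ne_zero_of_norm_ne_zero (hm q ▸ one_ne_zero)

theorem le_isotypic_out (W : IrreducibleSubrep U) :
    W.1 ≤ isotypic (coordinateRep.{w} (⟦W⟧ : Quotient (setoid.{w} U)).out.1) U := by
  obtain ⟨e⟩ := Quotient.mk_out (s := setoid.{w} U) W
  exact le_isotypic_coordinateRep.trans (isotypic_mono_of_equiv e)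

variable (U) in
theorem iSup_isotypic_out_eq_top :
    ⨆ q : Quotient (setoid.{w} U), (isotypic (coordinateRep.{w} q.out.1) U).toSubmodule = ⊤ := by
  let T : Subrepresentation (toRepresentation U) :=
    { toSubmodule := ⨆ q : Quotient (setoid.{w} U),
        (isotypic (coordinateRep.{w} q.out.1) U).toSubmodule
      apply_mem_toSubmodule := fun g =>
        (iSup_le fun q _ hx => Submodule.mem_iSup_of_mem q
          ((isotypic (coordinateRep.{w} q.out.1) U).apply_mem_toSubmodule g hx) :
          _ ≤ (⨆ q : Quotient (setoid.{w} U),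
            (isotypic (coordinateRep.{w} q.out.1) U).toSubmodule).comap (toRepresentation U g)) }
  have hT : T = ⊤ := eq_top_of_forall_isAtom_le fun W hW _ hx =>
    Submodule.mem_iSup_of_mem _ (le_isotypic_out ⟨W, hW⟩ hx)
  exact congrArg Subrepresentation.toSubmodule hT

end IrreducibleSubrep

open IrreducibleSubrep in
theorem nonempty_irrepDecomposition (U : G →* (H ≃ₗᵢ[ℂ] H)) :
    Nonempty (IrrepDecomposition.{w} U) := by
  obtain ⟨n, ⟨label⟩⟩ := Finite.exists_equiv_fin (Quotient (setoid.{w} U))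
  let ε := Equiv.ulift.{w}.trans label.symm
  choose k incl map_incl range_incl using fun μ =>
    exists_isotypic_inclusion.{w} U (coordinateRep.{w} (ε μ).out.1)
  have incl_mem μ x : incl μ x ∈ (isotypic (coordinateRep.{w} (ε μ).out.1) U).toSubmodule :=
    range_incl μ ▸ LinearMap.mem_range_self (incl μ).toLinearMap x
  have orthogonal : OrthogonalFamily ℂ _ incl := fun μ ν h x y =>
    Submodule.isOrtho_iff_inner_eq.1 (isOrtho_isotypic (isEmpty_equiv_out (ε.injective.ne h.symm)))
      _ (incl_mem μ x) _ (incl_mem ν y)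
  have iSup_range : ⨆ μ, LinearMap.range (incl μ).toLinearMap = ⊤ := by
    rw [iSup_congr range_incl, ← iSup_isotypic_out_eq_top.{w} U]
    exact ε.surjective.iSup_comp fun q : Quotient (setoid.{w} U) =>
      (isotypic (coordinateRep.{w} q.out.1) U).toSubmodule
  exact ⟨{
    Index := ULift.{w} (Fin n)
    M := fun μ =>
      EuclideanSpace ℂ (ULift.{w} (Fin (Module.finrank ℂ (ε μ).out.1.toSubmodule)))
    N := fun μ => EuclideanSpace ℂ (ULift.{w} (Fin (k μ)))
    irrep := fun μ => coordinateRep.{w} (ε μ).out.1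
    irreducible := fun μ => inferInstance
    inequivalent := fun μ ν h => isEmpty_equiv_out (ε.injective.ne h)
    incl, orthogonal, iSup_range
    map_incl := fun g μ => map_incl μ g }⟩

end Existence

end Asymmetry

end

theorem mainTheorem6_general {G : Type u} {H : Type v} [Group G] [NormedAddCommGroup H]
    [InnerProductSpace ℂ H] [FiniteDimensional ℂ H] (U : G →* (H ≃ₗᵢ[ℂ] H)) (ψ₁ ψ₂ : H) :
    Nonempty (Asymmetry.IrrepDecomposition.{w, u, v} U) ∧
    ∀ D : Asymmetry.IrrepDecomposition.{w, u, v} U,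
      (∀ V : Asymmetry.Intertwiner U U, (∀ x, ‖V x‖ ≤ ‖x‖) →
        ‖inner ℂ ψ₂ (V ψ₁)‖ ≤
          ∑ μ, Asymmetry.fid (D.pureReduction ψ₁ μ) (D.pureReduction ψ₂ μ)) ∧
      ∃ V : H ≃ₗᵢ[ℂ] H, Asymmetry.IsGInvariant U V ∧
        ‖inner ℂ ψ₂ (V ψ₁)‖ =
          ∑ μ, Asymmetry.fid (D.pureReduction ψ₁ μ) (D.pureReduction ψ₂ μ) :=
  ⟨Asymmetry.nonempty_irrepDecomposition U, fun D =>
    ⟨fun _ hV => D.norm_inner_le_sum_fid hV ψ₁ ψ₂, D.exists_isGInvariant_norm_inner_eq ψ₁ ψ₂⟩⟩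

theorem mainTheorem6 {G : Type u} {H : Type v} [Group G] [NormedAddCommGroup H]
    [InnerProductSpace ℂ H] [FiniteDimensional ℂ H] (U : G →* (H ≃ₗᵢ[ℂ] H))
    (ψ₁ ψ₂ : H) (hψ₁ : ‖ψ₁‖ = 1) (hψ₂ : ‖ψ₂‖ = 1) :
    Nonempty (Asymmetry.IrrepDecomposition.{w, u, v} U) ∧
    ∀ D : Asymmetry.IrrepDecomposition.{w, u, v} U,
      (∀ V : H ≃ₗᵢ[ℂ] H, Asymmetry.IsGInvariant U V →
        ‖inner ℂ ψ₂ (V ψ₁)‖ ≤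
          ∑ μ, Asymmetry.fid (D.pureReduction ψ₁ μ) (D.pureReduction ψ₂ μ)) ∧
      ∃ V : H ≃ₗᵢ[ℂ] H, Asymmetry.IsGInvariant U V ∧
        ‖inner ℂ ψ₂ (V ψ₁)‖ =
          ∑ μ, Asymmetry.fid (D.pureReduction ψ₁ μ) (D.pureReduction ψ₂ μ) := by
  obtain ⟨hD, h⟩ := mainTheorem6_general U ψ₁ ψ₂
  exact ⟨hD, fun D => ⟨fun V hV => (h D).1 hV.toIntertwiner fun x => (V.norm_map x).le, (h D).2⟩⟩
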